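/- Let $n\ge 2$ and let $K\subset\mathbb{R}^n$ be an $n$-simplex (the convex hull of $n+1$ affinely independent points). For a full-rank lattice $L\subset\mathbb{R}^n$, call the family of translates $\{K+x : x\in L\}$ *$(n-1)$-impassable* (non-separable) if every affine hyperplane of $\mathbb{R}^n$ meets at least one of the sets $K+x$, $x\in L$; the density of this family is $V(K)/D(L)$, where $V$ denotes volume and $D(L)$ is the volume of a basic parallelotope of $L$. Let $d_{n,n-1}(K)$ be the infimum of the densities of all $(n-1)$-impassable families $\{K+x : x\in L\}$, over all full-rank lattices $L\subset\mathbb{R}^n$. Then \[ d_{n,n-1}(K)=\frac{n+1}{2^n\,n!}=n^{-n}\left(\frac{e}{2}\right)^n e^{o(n)}, \] where the term $o(n)$ depends only on $n$ and refers to $n\to\infty$. -/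

import Mathlib

open MeasureTheory Asymptotics
open scoped Nat

/-- The lattice of translates `{K + x | x ∈ L}` of `K ⊆ ℝⁿ` is `k`-impassable: every affine
subspace of dimension `k` meets some body of the family. -/
def IsImpassable {n : ℕ} (k : ℕ) (K : Set (EuclideanSpace ℝ (Fin n)))
    (L : Submodule ℤ (EuclideanSpace ℝ (Fin n))) : Prop :=
  ∀ F : AffineSubspace ℝ (EuclideanSpace ℝ (Fin n)),
    (F : Set (EuclideanSpace ℝ (Fin n))).Nonempty → Module.finrank ℝ F.direction = k →
      ∃ x ∈ L, (((fun y => y + x) '' K) ∩ (F : Set (EuclideanSpace ℝ (Fin n)))).Nonempty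

/-- The density `V(K) / D(L)` of the lattice of translates `{K + x | x ∈ L}`, where `D(L)` is the
volume of a basic parallelotope of the (full rank) lattice `L`. -/
noncomputable def latticeDensity {n : ℕ} (K : Set (EuclideanSpace ℝ (Fin n)))
    (L : Submodule ℤ (EuclideanSpace ℝ (Fin n))) : ℝ :=
  volume.real K / ZLattice.covolume L

/-- `d_{n,k}(K)`: the infimum of the densities of the `k`-impassable lattices of translates of
`K`. Lattices in `ℝⁿ` are the discrete subgroups of `ℝⁿ` that span `ℝⁿ` over `ℝ`. -/
noncomputable def impassableDensity (n k : ℕ) (K : Set (EuclideanSpace ℝ (Fin n))) : ℝ :=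
  sInf {d : ℝ | ∃ (L : Submodule ℤ (EuclideanSpace ℝ (Fin n))) (_ : DiscreteTopology L),
    IsZLattice ℝ L ∧ IsImpassable k K L ∧ d = latticeDensity K L}

/-!
A family `K + L` meets every hyperplane exactly when the width of `K` in the direction of every
nonzero functional that is integral on `L` is at least `1`; that is, when the dual lattice `L*` has
no nonzero point in the symmetric convex body of functionals for which `K` has width `< 1`. So the
minimal density is the critical determinant of this body, times the volume of `K`.

For a simplex with vertices `p₀, …, pₙ` the width of `K` along `φ` is the oscillation
`max φ(pᵢ) - min φ(pᵢ)`. In the coordinates `uᵢ = φ(pᵢ) - φ(p₀)` the body becomes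
`{u | osc (0, u) < 1}` (`oscBody`), which up to null sets is a disjoint union of `n + 1`
unimodular images of the unit cube, one for each index at which the minimum can be attained;
its volume is therefore `n + 1` (only `≥` is needed, `le_volume_oscBody`). Coordinates with respect
to a basis of `L` turn `L` and `L*` into `ℤⁿ`, and the density into `|det A| / n!`, where the rows
of `A` are the edges `pᵢ - p₀` (`latticeDensity_convexHull_range`). Minkowski's theorem then gives
`n + 1 ≤ 2ⁿ |det A|` (`add_one_le_two_pow_mul_abs_det`), which is the lower bound.

The bound is attained because the body tiles: it is, up to a linear map, the Voronoi cell of the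
root lattice `Aₙ`. Taking `½ Aₙ` as dual lattice amounts to taking `A = ½ (I + J)` with `J` the
all-ones matrix, i.e. the lattice `L` generated by the vectors `2 (pᵢ - c)`, where `c` is the
centroid of `K`. That it is impassable is checked directly: the values of a nonzero functional `ψ`
at these `n + 1` vectors sum to `0`, so one is positive and one is negative, and the width of `K`
along `ψ` is at least the average of their absolute values, hence at least the smaller of them.
Translating by multiples of the corresponding generator makes `ψ` take every value on `K + L`
(`isImpassable_of_edgeMatrix_eq`).

The asymptotic form is Stirling's formula.
-/

/-! ### Asymptotics of the density -/

/-- The error exponent in the asymptotic form of the density; it is `o(n)` because Stirling's sequence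
converges to a positive limit. -/
theorem stirling_log_error_isLittleO :
    (fun n : ℕ => Real.log (n + 1) - Real.log (Stirling.stirlingSeq n) - Real.log (2 * n) / 2)
      =o[Filter.atTop] (fun n : ℕ => (n : ℝ)) := by
  have hlog : Real.log =o[Filter.atTop] (fun x : ℝ => x) := Real.isLittleO_log_id_atTop
  have hcast := tendsto_natCast_atTop_atTop (R := ℝ)
  have hO : ∀ c : ℝ, (fun _ : ℕ => c) =o[Filter.atTop] (fun n : ℕ => (n : ℝ)) := fun c =>
    isLittleO_const_left.2 (Or.inr (tendsto_norm_atTop_atTop.comp hcast))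
  have h1 : (fun n : ℕ => Real.log ((n : ℝ) + 1)) =o[Filter.atTop] (fun n : ℕ => (n : ℝ)) := by
    refine (hlog.comp_tendsto (Filter.tendsto_atTop_add_const_right _ 1 hcast)).trans_isBigO ?_
    exact (isBigO_refl _ _).add (hO 1).isBigO
  have h2 : (fun n : ℕ => Real.log (Stirling.stirlingSeq n)) =o[Filter.atTop]
      (fun n : ℕ => (n : ℝ)) := by
    have ht := Stirling.tendsto_stirlingSeq_sqrt_pi.log (Real.sqrt_pos.2 Real.pi_pos).ne'
    exact (ht.isBigO_one ℝ).trans_isLittleO (hO 1)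
  have h3 : (fun n : ℕ => Real.log (2 * (n : ℝ)) / 2) =o[Filter.atTop]
      (fun n : ℕ => (n : ℝ)) := by
    have := (hlog.comp_tendsto (hcast.const_mul_atTop (two_pos : (0 : ℝ) < 2))).trans_isBigO
      (isBigO_const_mul_self 2 (fun n : ℕ => (n : ℝ)) Filter.atTop)
    simpa [div_eq_inv_mul] using this.const_mul_left (2⁻¹ : ℝ)
  exact (h1.sub h2).sub h3

theorem simplex_density_eq_exp {n : ℕ} (hn : n ≠ 0) :
    ((n : ℝ) + 1) / (2 ^ n * (n ! : ℝ)) = ((n : ℝ) ^ n)⁻¹ * (Real.exp 1 / 2) ^ n *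
      Real.exp (Real.log (n + 1) - Real.log (Stirling.stirlingSeq n) - Real.log (2 * n) / 2) := by
  have hn' : (0 : ℝ) < n := by positivity
  have hs : 0 < Stirling.stirlingSeq n := by unfold Stirling.stirlingSeq; positivity
  rw [Real.exp_sub, Real.exp_sub, Real.exp_log (by positivity), Real.exp_log hs,
    ← Real.log_sqrt (by positivity), Real.exp_log (by positivity)]
  unfold Stirling.stirlingSeq
  field_simp
  rw [← mul_pow, ← mul_pow]
  congr 1
  field_simp

/-! ### Volume of a simplex -/

/-- The corner simplex of side `r`: the points with nonnegative coordinates of sum at most `r`. -/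
def cornerSimplex (n : ℕ) (r : ℝ) : Set (Fin n → ℝ) := {x | (∀ i, 0 ≤ x i) ∧ ∑ i, x i ≤ r}

theorem measurableSet_cornerSimplex (n : ℕ) (r : ℝ) : MeasurableSet (cornerSimplex n r) := by
  unfold cornerSimplex
  measurability

/-- By induction on `n`, slicing along the first coordinate. -/
theorem volume_cornerSimplex (n : ℕ) : ∀ r : ℝ, 0 ≤ r →
    volume (cornerSimplex n r) = ENNReal.ofReal (r ^ n / n !) := by
  induction n with
  | zero =>
    intro r hr
    have : cornerSimplex 0 r = Set.univ := by
      ext x; simp [cornerSimplex, hr]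
    simp [this, Measure.volume_pi_eq_dirac (0 : Fin 0 → ℝ)]
  | succ n ih =>
    intro r hr
    have hmp := (volume_preserving_piFinSuccAbove (fun _ : Fin (n + 1) => ℝ) 0).symm
    rw [← hmp.measure_preimage (measurableSet_cornerSimplex _ _).nullMeasurableSet,
      Measure.volume_eq_prod, Measure.prod_apply
        (hmp.measurable (measurableSet_cornerSimplex _ _))]
    have hslice : ∀ t : ℝ, volume (Prod.mk t ⁻¹'
        ((MeasurableEquiv.piFinSuccAbove (fun _ : Fin (n + 1) => ℝ) 0).symm ⁻¹'
          cornerSimplex (n + 1) r)) =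
        (Set.Icc 0 r).indicator (fun t => ENNReal.ofReal ((r - t) ^ n / n !)) t := by
      intro t
      have hmem : ∀ x : Fin n → ℝ, (MeasurableEquiv.piFinSuccAbove
          (fun _ : Fin (n + 1) => ℝ) 0).symm (t, x) ∈ cornerSimplex (n + 1) r ↔
          0 ≤ t ∧ x ∈ cornerSimplex n (r - t) := by
        intro x
        simp [cornerSimplex, MeasurableEquiv.piFinSuccAbove, Fin.forall_fin_succ,
          Fin.sum_univ_succ, and_assoc, le_sub_iff_add_le']
      by_cases ht : t ∈ Set.Icc 0 r
      · rw [Set.indicator_of_mem ht, ← ih (r - t) (sub_nonneg.2 ht.2)]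
        congr 1
        ext x
        exact (hmem x).trans (and_iff_right ht.1)
      · rw [Set.indicator_of_notMem ht]
        convert measure_empty (μ := (volume : Measure (Fin n → ℝ)))
        ext x
        refine ⟨fun hx => ht ?_, fun hx => hx.elim⟩
        obtain ⟨h0, hx, hs⟩ := (hmem x).1 hx
        exact ⟨h0, sub_nonneg.1 ((Finset.sum_nonneg fun i _ => hx i).trans hs)⟩
    simp_rw [hslice]
    rw [lintegral_indicator measurableSet_Icc, ← ofReal_integral_eq_lintegral_ofReal]
    · rw [integral_Icc_eq_integral_Ioc, ← intervalIntegral.integral_of_le hr,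
        intervalIntegral.integral_div, intervalIntegral.integral_comp_sub_left (fun x => x ^ n)]
      simp [integral_pow, Nat.factorial_succ]
      field_simp
    · exact (Continuous.integrableOn_Icc (by fun_prop))
    · filter_upwards [ae_restrict_mem measurableSet_Icc] with t ht
      have := sub_nonneg.2 ht.2
      positivity

/-- The matrix whose rows are the edge vectors `p₁ - p₀, …, pₙ - p₀`. -/
def edgeMatrix {n : ℕ} (p : Fin (n + 1) → Fin n → ℝ) : Matrix (Fin n) (Fin n) ℝ :=
  Matrix.of fun i j => p i.succ j - p 0 j

theorem convexHull_range_eq_image_cornerSimplex {n : ℕ} (p : Fin (n + 1) → Fin n → ℝ) :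
    convexHull ℝ (Set.range p) =
      (fun y => p 0 + y) '' (Matrix.toLin' (edgeMatrix p).transpose '' cornerSimplex n 1) := by
  have key : ∀ w : Fin n → ℝ, p 0 + Matrix.toLin' (edgeMatrix p).transpose w =
      (1 - ∑ i, w i) • p 0 + ∑ i, w i • p i.succ := by
    intro w
    ext j
    simp [Matrix.toLin'_apply, Matrix.mulVec, dotProduct, edgeMatrix, sub_mul,
      Finset.sum_sub_distrib, mul_comm, mul_sub]
    rw [Finset.sum_mul]
    ring
  rw [Set.image_image]
  apply subset_antisymm
  · refine convexHull_min ?_ ?_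
    · rintro _ ⟨i, rfl⟩
      refine Fin.cases ⟨0, by simp [cornerSimplex], by simp⟩ (fun i => ?_) i
      refine ⟨Pi.single i 1, ⟨fun j => ?_, by simp⟩, ?_⟩
      · by_cases h : j = i <;> simp [h]
      · refine (key _).trans ?_
        simp [Pi.single_apply]
    · rw [← Set.image_image (fun y => p 0 + y)]
      refine Convex.translate (Convex.linear_image ?_ _) _
      rintro x ⟨hx, hx'⟩ y ⟨hy, hy'⟩ a b ha hb hab
      refine ⟨fun i => by have := hx i; have := hy i; simp; positivity, ?_⟩
      simp only [Pi.add_apply, Pi.smul_apply, smul_eq_mul, Finset.sum_add_distrib,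
        ← Finset.mul_sum]
      nlinarith
  · rintro _ ⟨w, ⟨hw, hw'⟩, rfl⟩
    simp only [key]
    have := (convex_convexHull ℝ (Set.range p)).sum_mem (t := Finset.univ)
      (w := Fin.cons (1 - ∑ i, w i) w) (z := p) (fun i _ => ?_) ?_
      (fun i _ => subset_convexHull ℝ _ ⟨i, rfl⟩)
    · simpa [Fin.sum_univ_succ] using this
    · refine Fin.cases (by simpa using hw') (fun i => by simpa using hw i) i
    · simp [Fin.sum_univ_succ]

theorem volume_real_convexHull_range {n : ℕ} (p : Fin (n + 1) → Fin n → ℝ) :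
    volume.real (convexHull ℝ (Set.range p)) = |(edgeMatrix p).det| / n ! := by
  rw [measureReal_def, convexHull_range_eq_image_cornerSimplex, Set.image_add_left,
    measure_preimage_add,
    Measure.addHaar_image_linearMap, volume_cornerSimplex n 1 zero_le_one, LinearMap.det_toLin',
    Matrix.det_transpose, ENNReal.toReal_mul, ENNReal.toReal_ofReal (abs_nonneg _),
    ENNReal.toReal_ofReal (by positivity), one_pow, mul_one_div]

/-! ### The body of functionals of small oscillation -/

/-- The open symmetric convex body of all `u ∈ ℝⁿ` for which the `n + 1` numbers
`0, u₁, …, uₙ` oscillate by less than `1`. Here `u` records the values `φ(pᵢ) - φ(p₀)` of a linear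
functional at the vertices of a simplex. -/
def oscBody (n : ℕ) : Set (Fin n → ℝ) :=
  {u | ∀ i j : Fin (n + 1), (Fin.cons 0 u : Fin (n + 1) → ℝ) i -
    (Fin.cons 0 u : Fin (n + 1) → ℝ) j < 1}

/-- The part of `oscBody n` on which, among the numbers `0, u₁, …, uₙ`, the one of index `i` is the
strict minimum. -/
def oscPiece {n : ℕ} (i : Fin (n + 1)) : Set (Fin n → ℝ) :=
  {u | ∀ j, j ≠ i → (Fin.cons 0 u : Fin (n + 1) → ℝ) j -
    (Fin.cons 0 u : Fin (n + 1) → ℝ) i ∈ Set.Ioo (0 : ℝ) 1}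

theorem oscPiece_zero {n : ℕ} :
    oscPiece (0 : Fin (n + 1)) = Set.univ.pi fun _ : Fin n => Set.Ioo (0 : ℝ) 1 := by
  ext u
  simp [oscPiece, Fin.forall_fin_succ]

/-- The linear map that subtracts `uₖ` from each of `0, u₁, …, uₙ` and exchanges the entries of
index `0` and `k`, so that entry `0` vanishes again. It moves a minimum at index `k` to index `0`. -/
def renormalize {n : ℕ} (k : Fin n) : (Fin n → ℝ) →ₗ[ℝ] (Fin n → ℝ) where
  toFun u j := if j = k then -u k else u j - u k
  map_add' u v := by
    ext j
    by_cases h : j = k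
    · simp [h, add_comm]
    · simp [h, add_sub_add_comm]
  map_smul' c u := by
    ext j
    by_cases h : j = k <;> simp [h, mul_sub]

theorem renormalize_comp_self {n : ℕ} (k : Fin n) :
    renormalize k ∘ₗ renormalize k = LinearMap.id := by
  refine LinearMap.ext fun u => funext fun j => ?_
  by_cases h : j = k <;> simp [renormalize, h]

/-- The map is an involution, so its determinant is `±1`. -/
theorem abs_det_renormalize {n : ℕ} (k : Fin n) : |LinearMap.det (renormalize k)| = 1 := by
  have h := congrArg LinearMap.det (renormalize_comp_self k)
  rw [LinearMap.det_comp, LinearMap.det_id] at h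
  rw [← sq_eq_sq₀ (abs_nonneg _) zero_le_one, sq_abs, sq, h, one_pow]

theorem oscPiece_succ {n : ℕ} (k : Fin n) :
    oscPiece k.succ = renormalize k ⁻¹' oscPiece 0 := by
  ext u
  simp only [oscPiece, Set.mem_ofPred_eq, Set.mem_preimage, Fin.forall_fin_succ, renormalize,
    LinearMap.coe_mk, AddHom.coe_mk, Fin.cons_zero, Fin.cons_succ, ne_eq, not_true_eq_false,
    false_imp_iff, true_and, Fin.succ_ne_zero, not_false_eq_true, true_imp_iff, sub_zero,
    Fin.succ_inj, (Fin.succ_ne_zero k).symm, zero_sub]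
  constructor
  · rintro ⟨h0, h⟩ j
    split_ifs with hj
    exacts [h0, h j hj]
  · refine fun h => ⟨by simpa using h k, fun j hj => by simpa [hj] using h j⟩

theorem volume_oscPiece {n : ℕ} (i : Fin (n + 1)) : volume (oscPiece i) = 1 := by
  have h0 : volume (oscPiece (0 : Fin (n + 1))) = 1 := by
    simp [oscPiece_zero, volume_pi_pi]
  refine Fin.cases h0 (fun k => ?_) i
  have hdet := abs_det_renormalize k
  rw [oscPiece_succ, Measure.addHaar_preimage_linearMap _ (fun h => by simp [h] at hdet),
    abs_inv, hdet, h0]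
  simp

theorem measurableSet_oscPiece {n : ℕ} (i : Fin (n + 1)) : MeasurableSet (oscPiece i) := by
  have h0 : MeasurableSet (oscPiece (0 : Fin (n + 1))) := by
    rw [oscPiece_zero]
    exact MeasurableSet.univ_pi fun _ => measurableSet_Ioo
  refine Fin.cases h0 (fun k => ?_) i
  rw [oscPiece_succ]
  exact (renormalize k).continuous_of_finiteDimensional.measurable h0

theorem oscPiece_subset_oscBody {n : ℕ} (i : Fin (n + 1)) : oscPiece i ⊆ oscBody n := by
  intro u hu j k
  have h : ∀ j, 0 ≤ (Fin.cons 0 u : Fin (n + 1) → ℝ) j - (Fin.cons 0 u : Fin (n + 1) → ℝ) i ∧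
      (Fin.cons 0 u : Fin (n + 1) → ℝ) j - (Fin.cons 0 u : Fin (n + 1) → ℝ) i < 1 := by
    intro j
    by_cases hj : j = i
    · simp [hj]
    · exact ⟨(hu j hj).1.le, (hu j hj).2⟩
  linarith [(h j).2, (h k).1]

theorem pairwise_disjoint_oscPiece {n : ℕ} :
    Pairwise (Function.onFun Disjoint (oscPiece : Fin (n + 1) → Set (Fin n → ℝ))) := by
  intro i j hij
  refine Set.disjoint_left.2 fun u hi hj => ?_
  linarith [(hi j hij.symm).1, (hj i hij).1]

theorem le_volume_oscBody (n : ℕ) : (n + 1 : ENNReal) ≤ volume (oscBody n) := by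
  calc (n + 1 : ENNReal) = ∑ i : Fin (n + 1), volume (oscPiece i) := by simp [volume_oscPiece]
    _ = volume (⋃ i : Fin (n + 1), oscPiece i) := by
        rw [measure_iUnion pairwise_disjoint_oscPiece measurableSet_oscPiece, tsum_fintype]
    _ ≤ _ := measure_mono (Set.iUnion_subset oscPiece_subset_oscBody)

theorem neg_mem_oscBody {n : ℕ} {u : Fin n → ℝ} (hu : u ∈ oscBody n) : -u ∈ oscBody n := by
  have h : ∀ i, (Fin.cons 0 (-u) : Fin (n + 1) → ℝ) i = -(Fin.cons 0 u : Fin (n + 1) → ℝ) i :=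
    Fin.cases (by simp) (by simp)
  intro i j
  rw [h, h]
  linarith [hu j i]

theorem convex_oscBody (n : ℕ) : Convex ℝ (oscBody n) := by
  intro u hu v hv a b ha hb hab i j
  have h : ∀ i, (Fin.cons 0 (a • u + b • v) : Fin (n + 1) → ℝ) i =
      a * (Fin.cons 0 u : Fin (n + 1) → ℝ) i + b * (Fin.cons 0 v : Fin (n + 1) → ℝ) i :=
    Fin.cases (by simp) (by simp)
  rw [h, h]
  have hc := convex_Iio (1 : ℝ) (hu i j) (hv i j) ha hb hab
  simp only [smul_eq_mul, Set.mem_Iio] at hc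
  linarith

/-- Minkowski's theorem for the preimage of `oscBody n` under `A`, whose volume is at least
`(n + 1) / |det A|`, and the lattice `ℤⁿ`. -/
theorem add_one_le_two_pow_mul_abs_det {n : ℕ} {A : Matrix (Fin n) (Fin n) ℝ} (hA : A.det ≠ 0)
    (h : ∀ m : Fin n → ℤ, m ≠ 0 → A.mulVec (fun i => (m i : ℝ)) ∉ oscBody n) :
    (n : ℝ) + 1 ≤ 2 ^ n * |A.det| := by
  by_contra! hlt
  have hdet : LinearMap.det (Matrix.toLin' A) ≠ 0 := by rwa [LinearMap.det_toLin']
  have hvol : volume (ZSpan.fundamentalDomain (Pi.basisFun ℝ (Fin n))) *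
      2 ^ Module.finrank ℝ (Fin n → ℝ) < volume (Matrix.toLin' A ⁻¹' oscBody n) := by
    rw [Measure.addHaar_preimage_linearMap _ hdet, LinearMap.det_toLin']
    refine lt_of_lt_of_le ?_ (mul_le_mul_right (le_volume_oscBody n) _)
    have h1 : (n + 1 : ENNReal) = ENNReal.ofReal (n + 1) := by
      rw [ENNReal.ofReal_add (by positivity) zero_le_one]; simp
    have h2 : (2 : ENNReal) ^ n = ENNReal.ofReal (2 ^ n) := by
      rw [ENNReal.ofReal_pow zero_le_two]; simp
    have hpos := abs_pos.2 hA
    rw [ZSpan.fundamentalDomain_pi_basisFun, volume_pi_pi]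
    simp only [Real.volume_Ico, sub_zero, ENNReal.ofReal_one, Finset.prod_const_one, one_mul,
      Module.finrank_fin_fun]
    rw [h1, h2, ← ENNReal.ofReal_mul (abs_nonneg _), abs_inv,
      ENNReal.ofReal_lt_ofReal_iff (by positivity), lt_inv_mul_iff₀ hpos, mul_comm]
    exact hlt
  have : Countable (Submodule.span ℤ (Set.range (Pi.basisFun ℝ (Fin n)))).toAddSubgroup :=
    inferInstanceAs (Countable (Submodule.span ℤ (Set.range (Pi.basisFun ℝ (Fin n)))))
  obtain ⟨x, hx0, hx⟩ := exists_ne_zero_mem_lattice_of_measure_mul_two_pow_lt_measure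
    (ZSpan.isAddFundamentalDomain' (Pi.basisFun ℝ (Fin n)) volume)
    (fun x hx => by
      rw [Set.mem_preimage, map_neg]
      exact neg_mem_oscBody hx)
    ((convex_oscBody n).linear_preimage _) hvol
  have hint := ((Pi.basisFun ℝ (Fin n)).mem_span_iff_repr_mem ℤ (x : Fin n → ℝ)).1 x.2
  choose m hm using hint
  have hm' : (fun i => (m i : ℝ)) = (x : Fin n → ℝ) := funext fun i => by simpa using hm i
  refine h m (fun h0 => hx0 (Subtype.ext ?_)) ?_
  · rw [← hm', h0]
    ext i
    simp
  · rw [hm']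
    exact hx

/-! ### Simplices in lattice coordinates -/

/-- In coordinates with respect to a `ℤ`-basis of `L`, the lattice has covolume `1`, so the density is
the volume of the image of the simplex. -/
theorem latticeDensity_convexHull_range {n : ℕ} (p : Fin (n + 1) → EuclideanSpace ℝ (Fin n))
    (L : Submodule ℤ (EuclideanSpace ℝ (Fin n))) [DiscreteTopology L] [IsZLattice ℝ L]
    (b : Module.Basis (Fin n) ℤ L) :
    latticeDensity (convexHull ℝ (Set.range p)) L =
      |(edgeMatrix fun i => (b.ofZLatticeBasis ℝ L).equivFun (p i)).det| / n ! := by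
  have hK : NullMeasurableSet (convexHull ℝ (Set.range p)) :=
    ((Set.finite_range p).isCompact_convexHull ℝ).measurableSet.nullMeasurableSet
  have h := congrArg ENNReal.toReal (ZLattice.volume_image_eq_volume_div_covolume' L b hK)
  rw [ENNReal.toReal_div, ENNReal.toReal_ofReal (ZLattice.covolume_pos L volume).le] at h
  rw [latticeDensity, measureReal_def, ← h, ← volume_real_convexHull_range, measureReal_def]
  have himage := LinearMap.image_convexHull
    ((b.ofZLatticeBasis ℝ L).equivFun : EuclideanSpace ℝ (Fin n) →ₗ[ℝ] Fin n → ℝ) (Set.range p)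
  rw [LinearEquiv.coe_coe] at himage
  rw [himage, ← Set.range_comp]
  rfl

theorem det_edgeMatrix_ne_zero {n : ℕ} {p : Fin (n + 1) → Fin n → ℝ}
    (hp : AffineIndependent ℝ p) : (edgeMatrix p).det ≠ 0 := by
  rw [affineIndependent_iff_linearIndependent_vsub ℝ p 0] at hp
  have hrow : LinearIndependent ℝ (edgeMatrix p).row :=
    hp.comp (fun i : Fin n => ⟨i.succ, Fin.succ_ne_zero i⟩)
      (fun i j hij => Fin.succ_injective n (congrArg Subtype.val hij))
  rw [Matrix.linearIndependent_rows_iff_isUnit, Matrix.isUnit_iff_isUnit_det] at hrow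
  exact hrow.ne_zero

theorem det_edgeMatrix_map_ne_zero {n : ℕ} (S : Affine.Simplex ℝ (EuclideanSpace ℝ (Fin n)) n)
    (e : EuclideanSpace ℝ (Fin n) ≃ₗ[ℝ] (Fin n → ℝ)) :
    (edgeMatrix fun i => e (S.points i)).det ≠ 0 :=
  det_edgeMatrix_ne_zero (S.independent.map' e.toLinearMap.toAffineMap e.injective)

/-- All simplices are affinely equivalent: the edge matrix of `S` can be made any given invertible
matrix by a choice of linear coordinates. -/
theorem exists_linearEquiv_edgeMatrix_eq {n : ℕ}
    (S : Affine.Simplex ℝ (EuclideanSpace ℝ (Fin n)) n) {M : Matrix (Fin n) (Fin n) ℝ}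
    (hM : M.det ≠ 0) : ∃ e : EuclideanSpace ℝ (Fin n) ≃ₗ[ℝ] (Fin n → ℝ),
      (edgeMatrix fun i => e (S.points i)) = M := by
  let e₀ : EuclideanSpace ℝ (Fin n) ≃ₗ[ℝ] (Fin n → ℝ) := WithLp.linearEquiv 2 ℝ (Fin n → ℝ)
  set A := edgeMatrix fun i => e₀ (S.points i) with hA
  have hdet : IsUnit A.det := (det_edgeMatrix_map_ne_zero S e₀).isUnit
  let N := (A⁻¹ * M).transpose
  have hN : IsUnit N.det := by
    rw [Matrix.det_transpose, Matrix.det_mul]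
    exact (Matrix.isUnit_nonsing_inv_det A hdet).mul hM.isUnit
  refine ⟨e₀.trans (Matrix.toLinearEquiv' N (Matrix.invertibleOfIsUnitDet N hN)), ?_⟩
  rw [← Matrix.mul_nonsing_inv_cancel_left A M hdet]
  ext i j
  have hmul : (A * (A⁻¹ * M)) i j = N.mulVec (A i) j := by
    simp [N, Matrix.mul_apply, Matrix.mulVec, dotProduct, mul_comm]
  have hrow : A i = e₀ (S.points i.succ) - e₀ (S.points 0) := rfl
  rw [hmul, hrow, Matrix.mulVec_sub]
  rfl

theorem cons_edgeMatrix_mulVec {n : ℕ} (p : Fin (n + 1) → Fin n → ℝ) (m : Fin n → ℝ)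
    (i : Fin (n + 1)) :
    (Fin.cons 0 ((edgeMatrix p).mulVec m) : Fin (n + 1) → ℝ) i = m ⬝ᵥ p i - m ⬝ᵥ p 0 := by
  refine Fin.cases (by simp) (fun i => ?_) i
  simp [edgeMatrix, Matrix.mulVec, dotProduct, sub_mul, mul_comm (m _)]

/-! ### The lower bound -/

/-- The integer vector `m` stands for the functional `ψ` that takes integer values on `L`. If the
simplex had width less than `1` along `ψ`, then some hyperplane `ψ = t` would pass through the gap
between `K` and its translates. -/
theorem IsImpassable.edgeMatrix_mulVec_notMem_oscBody {n : ℕ}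
    {p : Fin (n + 1) → EuclideanSpace ℝ (Fin n)} {L : Submodule ℤ (EuclideanSpace ℝ (Fin n))}
    [DiscreteTopology L] [IsZLattice ℝ L] (b : Module.Basis (Fin n) ℤ L)
    (hL : IsImpassable (n - 1) (convexHull ℝ (Set.range p)) L) {m : Fin n → ℤ} (hm : m ≠ 0) :
    (edgeMatrix fun i => (b.ofZLatticeBasis ℝ L).equivFun (p i)).mulVec (fun i => (m i : ℝ)) ∉
      oscBody n := by
  intro hmem
  let B := b.ofZLatticeBasis ℝ L
  let ψ : EuclideanSpace ℝ (Fin n) →ₗ[ℝ] ℝ :=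
    (dotProductBilin ℝ ℝ (fun i => (m i : ℝ))) ∘ₗ B.equivFun.toLinearMap
  have hψ : ∀ x, ψ x = (fun i => (m i : ℝ)) ⬝ᵥ B.equivFun x := fun x => rfl
  have hint : ∀ x ∈ L, ∃ k : ℤ, ψ x = k := by
    intro x hx
    refine ⟨∑ i, m i * b.repr ⟨x, hx⟩ i, ?_⟩
    rw [hψ]
    simp only [dotProduct, Module.Basis.equivFun_apply, Int.cast_sum, Int.cast_mul]
    exact Finset.sum_congr rfl fun i _ => by
      rw [← b.ofZLatticeBasis_repr_apply ℝ L ⟨x, hx⟩ i]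
  have hψ0 : ψ ≠ 0 := by
    intro h0
    refine hm (funext fun i => ?_)
    have := LinearMap.congr_fun h0 (B i)
    rw [hψ] at this
    simpa [dotProduct, Finsupp.single_apply] using this
  have hosc : ∀ i j, ψ (p i) - ψ (p j) < 1 := by
    intro i j
    have := hmem i j
    rw [cons_edgeMatrix_mulVec, cons_edgeMatrix_mulVec, sub_sub_sub_cancel_right] at this
    exact this
  -- The values of `ψ` on `K` lie strictly between `t - 1` and `t`.
  obtain ⟨t, ht⟩ : ∃ t, ∀ i, ψ (p i) ∈ Set.Ioo (t - 1) t := by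
    obtain ⟨i, hi⟩ := Finite.exists_max fun i => ψ (p i)
    obtain ⟨j, hj⟩ := Finite.exists_min fun i => ψ (p i)
    refine ⟨(ψ (p i) + ψ (p j) + 1) / 2, fun k => ⟨?_, ?_⟩⟩
    · linarith [hj k, hosc i j]
    · linarith [hi k, hosc i j]
  have hK : convexHull ℝ (Set.range p) ⊆ ψ ⁻¹' Set.Ioo (t - 1) t :=
    convexHull_min (Set.range_subset_iff.2 ht) ((convex_Ioo _ _).linear_preimage ψ)
  obtain ⟨x₀, hx₀⟩ := LinearMap.surjective hψ0 t
  obtain ⟨x, hxL, z, ⟨y, hy, rfl⟩, hz⟩ := hL (AffineSubspace.mk' x₀ (LinearMap.ker ψ))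
    ⟨x₀, AffineSubspace.self_mem_mk' _ _⟩ (by
      have := Module.Dual.finrank_ker_add_one_of_ne_zero (f := ψ) hψ0
      rw [finrank_euclideanSpace_fin] at this
      rw [AffineSubspace.direction_mk']
      exact Nat.eq_sub_of_add_eq this)
  obtain ⟨k, hk⟩ := hint x hxL
  have heq : ψ y + k = t := by
    have := AffineSubspace.mem_mk'.1 hz
    simp only [LinearMap.mem_ker, vsub_eq_sub, map_sub, map_add, hk, hx₀] at this
    linarith
  obtain ⟨hy1, hy2⟩ := hK hy
  have h1 : (0 : ℝ) < k := by linarith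
  have h2 : (k : ℝ) < 1 := by linarith
  norm_cast at h1 h2
  omega

theorem le_latticeDensity_of_isImpassable {n : ℕ}
    (S : Affine.Simplex ℝ (EuclideanSpace ℝ (Fin n)) n)
    (L : Submodule ℤ (EuclideanSpace ℝ (Fin n))) [DiscreteTopology L] [IsZLattice ℝ L]
    (hL : IsImpassable (n - 1) (convexHull ℝ (Set.range S.points)) L) :
    ((n : ℝ) + 1) / (2 ^ n * (n ! : ℝ)) ≤
      latticeDensity (convexHull ℝ (Set.range S.points)) L := by
  have : Module.Free ℤ L := ZLattice.module_free ℝ L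
  have : Module.Finite ℤ L := ZLattice.module_finite ℝ L
  let b : Module.Basis (Fin n) ℤ L :=
    Module.finBasisOfFinrankEq ℤ L (by rw [ZLattice.rank ℝ, finrank_euclideanSpace_fin])
  have h := add_one_le_two_pow_mul_abs_det (det_edgeMatrix_map_ne_zero S
    (b.ofZLatticeBasis ℝ L).equivFun) fun m hm => hL.edgeMatrix_mulVec_notMem_oscBody b hm
  rw [latticeDensity_convexHull_range S.points L b, ← div_div]
  gcongr
  rwa [div_le_iff₀' (by positivity)]

/-! ### An optimal lattice -/

/-- The matrix `½ (I + J)`, with `J` the all-ones matrix: the edge matrix of the simplex in coordinates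
with respect to the basis `2 (pᵢ - c)`, `i = 1, …, n`, of the optimal lattice, where `c` is the
centroid. -/
noncomputable def optimalEdgeMatrix (n : ℕ) : Matrix (Fin n) (Fin n) ℝ :=
  (2 : ℝ)⁻¹ • (1 + Matrix.of fun _ _ => 1)

theorem det_optimalEdgeMatrix (n : ℕ) : (optimalEdgeMatrix n).det = ((n : ℝ) + 1) / 2 ^ n := by
  have h : (Matrix.of fun _ _ => 1 : Matrix (Fin n) (Fin n) ℝ) =
      Matrix.replicateCol Unit (fun _ : Fin n => (1 : ℝ)) *
        Matrix.replicateRow Unit (fun _ : Fin n => (1 : ℝ)) := by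
    ext i j
    simp [Matrix.mul_apply]
  rw [optimalEdgeMatrix, Matrix.det_smul, h, Matrix.det_one_add_replicateCol_mul_replicateRow]
  simp [dotProduct]
  ring

/-- If `ψ` increases along a segment of `K` by at least `ψ z > 0`, then `ψ` takes every real value on
the translates of `K` by integer multiples of `z`. -/
theorem exists_mem_add_zsmul_map_eq {E : Type*} [AddCommGroup E] [Module ℝ E] {K : Set E}
    (hK : Convex ℝ K) (ψ : E →ₗ[ℝ] ℝ) {x y z : E} (hx : x ∈ K) (hy : y ∈ K) (hz : 0 < ψ z)
    (h : ψ z ≤ ψ y - ψ x) (t : ℝ) : ∃ w ∈ K, ∃ k : ℤ, ψ (w + k • z) = t := by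
  obtain ⟨k, ⟨hk1, hk2⟩, -⟩ := existsUnique_sub_zsmul_mem_Ico hz t (ψ x)
  have hmem : t - k • ψ z ∈ ψ '' segment ℝ x y := by
    have himage := image_segment ℝ ψ.toAffineMap x y
    rw [LinearMap.coe_toAffineMap] at himage
    rw [himage, segment_eq_Icc (by linarith)]
    exact ⟨hk1, by linarith⟩
  obtain ⟨w, hw, hwt⟩ := hmem
  refine ⟨w, hK.segment_subset hx hy hw, k, ?_⟩
  rw [map_add, hwt, map_zsmul, sub_add_cancel]

/-- The lattice spanned by a basis in which the simplex has edge matrix `½ (I + J)` is impassable: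
along each functional, the width of the simplex is at least the smaller of a positive and the modulus
of a negative value of the functional on lattice vectors. -/
theorem isImpassable_of_edgeMatrix_eq {n : ℕ} (hn : n ≠ 0)
    {p : Fin (n + 1) → EuclideanSpace ℝ (Fin n)}
    (B : Module.Basis (Fin n) ℝ (EuclideanSpace ℝ (Fin n)))
    (hB : (edgeMatrix fun i => B.equivFun (p i)) = optimalEdgeMatrix n) :
    IsImpassable (n - 1) (convexHull ℝ (Set.range p)) (Submodule.span ℤ (Set.range B)) := by
  intro F ⟨x₀, hx₀⟩ hF
  obtain ⟨ψ, hψ0, hψF⟩ := Submodule.exists_le_ker_of_lt_top F.direction (by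
    refine lt_top_iff_ne_top.2 fun h => ?_
    rw [h, finrank_top, finrank_euclideanSpace_fin] at hF
    omega)
  have hker : F.direction = LinearMap.ker ψ := by
    refine Submodule.eq_of_le_of_finrank_eq hψF ?_
    have := Module.Dual.finrank_ker_add_one_of_ne_zero (f := ψ) hψ0
    rw [finrank_euclideanSpace_fin] at this
    omega
  have hmemF : ∀ x, ψ x = ψ x₀ → x ∈ F := by
    intro x hx
    rw [← AffineSubspace.vsub_right_mem_direction_iff_mem hx₀, hker, LinearMap.mem_ker,
      vsub_eq_sub, map_sub, hx, sub_self]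
  -- Together with minus their sum, the basis vectors are the `n + 1` vectors `2 (pᵢ - centroid)`.
  let c : Fin (n + 1) → EuclideanSpace ℝ (Fin n) := Fin.cons (-∑ i, B i) B
  have hBmem : ∀ i, B i ∈ Submodule.span ℤ (Set.range B) := fun i =>
    Submodule.subset_span ⟨i, rfl⟩
  have hc : ∀ i, c i ∈ Submodule.span ℤ (Set.range B) :=
    Fin.cases (neg_mem (sum_mem fun i _ => hBmem i)) hBmem
  have hsum : ∑ i, ψ (c i) = 0 := by simp [c, Fin.sum_univ_succ]
  have hp : ∀ i, ψ (p i) = ψ (p 0) + (ψ (c i) - ψ (c 0)) / 2 := by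
    refine Fin.cases (by simp) fun i => ?_
    have hexp : ψ (p i.succ - p 0) = ∑ j, optimalEdgeMatrix n i j * ψ (B j) := by
      rw [← hB]
      conv_lhs => rw [← B.sum_equivFun (p i.succ - p 0)]
      simp [edgeMatrix]
    rw [map_sub, sub_eq_iff_eq_add'] at hexp
    rw [hexp]
    simp only [optimalEdgeMatrix, Matrix.smul_apply, Matrix.add_apply, Matrix.of_apply,
      Matrix.one_apply, c, Fin.cons_succ, Fin.cons_zero, map_neg, map_sum, smul_eq_mul, mul_assoc,
      ← Finset.mul_sum, add_mul, one_mul, ite_mul, zero_mul, Finset.sum_add_distrib,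
      Finset.sum_ite_eq, Finset.mem_univ, if_true]
    ring
  have hne : ∃ i ∈ Finset.univ, ψ (c i) ≠ 0 := by
    by_contra! h
    refine hψ0 (B.ext fun i => ?_)
    simpa [c] using h i.succ (Finset.mem_univ _)
  obtain ⟨i, -, hi⟩ := Finset.exists_pos_of_sum_zero_of_exists_nonzero _ hsum hne
  obtain ⟨j, -, hj⟩ := Finset.exists_pos_of_sum_zero_of_exists_nonzero (fun i => -ψ (c i))
    (by simpa using hsum) (by simpa using hne)
  have hgap : ψ (p i) - ψ (p j) = (ψ (c i) - ψ (c j)) / 2 := by rw [hp i, hp j]; ring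
  obtain ⟨z, hz, hz0, hzle⟩ : ∃ z ∈ Submodule.span ℤ (Set.range B),
      0 < ψ z ∧ ψ z ≤ ψ (p i) - ψ (p j) := by
    rcases le_total (ψ (c i)) (-ψ (c j)) with h | h
    · exact ⟨c i, hc i, hi, by linarith⟩
    · exact ⟨-c j, neg_mem (hc j), by simpa using hj, by rw [map_neg]; linarith⟩
  obtain ⟨w, hw, k, hk⟩ := exists_mem_add_zsmul_map_eq (convex_convexHull ℝ (Set.range p)) ψ
    (subset_convexHull ℝ _ ⟨j, rfl⟩) (subset_convexHull ℝ _ ⟨i, rfl⟩) hz0 hzle (ψ x₀)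
  exact ⟨k • z, Submodule.smul_mem _ k hz, w + k • z, ⟨w, hw, rfl⟩, hmemF _ hk⟩

theorem exists_isImpassable_latticeDensity_eq {n : ℕ} (hn : n ≠ 0)
    (S : Affine.Simplex ℝ (EuclideanSpace ℝ (Fin n)) n) :
    ∃ (L : Submodule ℤ (EuclideanSpace ℝ (Fin n))) (_ : DiscreteTopology L),
      IsZLattice ℝ L ∧ IsImpassable (n - 1) (convexHull ℝ (Set.range S.points)) L ∧
        ((n : ℝ) + 1) / (2 ^ n * (n ! : ℝ)) =
          latticeDensity (convexHull ℝ (Set.range S.points)) L := by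
  have hdet := det_optimalEdgeMatrix n
  obtain ⟨e, he⟩ := exists_linearEquiv_edgeMatrix_eq S (M := optimalEdgeMatrix n)
    (by rw [hdet]; positivity)
  let B := Module.Basis.ofEquivFun e
  have heB : B.equivFun = e := Module.Basis.equivFun_ofEquivFun e
  refine ⟨Submodule.span ℤ (Set.range B), inferInstance, inferInstance,
    isImpassable_of_edgeMatrix_eq hn B (by rw [heB, he]), ?_⟩
  have hbasis : (B.restrictScalars ℤ).ofZLatticeBasis ℝ (Submodule.span ℤ (Set.range B)) = B := by
    ext1 i
    simp
  rw [latticeDensity_convexHull_range S.points _ (B.restrictScalars ℤ), hbasis, heB, he, hdet,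
    abs_of_nonneg (by positivity), div_div]

/-! ### The minimal density -/

theorem proposition3p1 :
    (∀ (n : ℕ), 2 ≤ n → ∀ S : Affine.Simplex ℝ (EuclideanSpace ℝ (Fin n)) n,
      impassableDensity n (n - 1) (convexHull ℝ (Set.range S.points))
        = ((n : ℝ) + 1) / (2 ^ n * (n ! : ℝ))) ∧
    ∃ ε : ℕ → ℝ, ε =o[Filter.atTop] (fun n : ℕ => (n : ℝ)) ∧
      ∀ n : ℕ, 2 ≤ n →
        ((n : ℝ) + 1) / (2 ^ n * (n ! : ℝ))
          = ((n : ℝ) ^ n)⁻¹ * (Real.exp 1 / 2) ^ n * Real.exp (ε n) := by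
  refine ⟨fun n hn S => IsLeast.csInf_eq ⟨?_, ?_⟩,
    _, stirling_log_error_isLittleO, fun n hn => simplex_density_eq_exp (by omega)⟩
  · exact exists_isImpassable_latticeDensity_eq (by omega) S
  · rintro d ⟨L, hdisc, hlat, himp, rfl⟩
    exact le_latticeDensity_of_isImpassable S L himp
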